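/- Let $\mathcal A$ be a set with a binary application, written by juxtaposition and associating to the left, and with elements $B,I,C^+,C^-,\theta^+,\theta^-,T$. Write $a\circ b=B\,a\,b$, $a^0=I$, $a^{n+1}=a\circ a^n$ and $a^\bullet=C^+\,I\,a$. In the axioms below, $\pm$ and $\mp$ are linked signs, each $\star$ is an arbitrary choice of sign, and $a,b,c$ range over $\mathcal A$. Assume that $\mathcal A$ is a traced balanced extensional $\mathbf{BC^{\pm}I}$-algebra with trace combinator $T$, that is: (extensional $\mathbf{BC^\pm I}$-algebra) $B\,a\,b\,c=a\,(b\,c)$; $C^\star a\,b\,c=a\,c\,b$; $I\,a=a$; $C^+a\,b=C^-a\,b$; $B\,I=I$; $C^\star B\,I=B\,I$; $(C^\star B\,B)\circ(B\circ B)=(B\,B)\circ B$; $C^\pm\circ C^\mp=B\,(B\,I)$; $(C^\star B\,C^\pm)\circ(B\circ B)=(B\,C^\pm)\circ(B\circ B)$; $(B\,C^\pm)\circ(C^\pm\circ(B\,C^\pm))=C^\pm\circ((B\,C^\pm)\circ C^\pm)$; $(B\,B)\circ C^\pm=C^\pm\circ((B\,C^\pm)\circ B)$; (balanced) $(B\,\theta^\pm)\circ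 B=(C^\star B\,\theta^\pm)\circ B$; $\theta^\pm\circ\theta^\mp=B\,I$; $C^\star\,\theta^\star\,a=C^\star I\,a$; $B\circ\theta^\pm=\theta^\pm\circ C^\pm\circ\theta^\pm\circ C^\pm\circ B$; (traced) $(C^\star B\,T)\circ B=(B\,T)\circ B^2$; $(B\,T)\circ(C^\star B\,B)\circ B=B\circ T$; $T\,C^\pm=\theta^\pm$; $T^2\circ(C^\star B\,C^-)\circ(B\,C^+)=T^2$. Say that an element $a$ has arity $m\to n$ if $a^\bullet\circ B^{m+1}=(B\,a)\circ B^n$. Put $$\alpha=T\,(T\circ(B\,T)\circ(B\,C^+)\circ C^+),\qquad \beta=T\,(C^+\circ(B\,C^+)\circ(B\,B)\circ B).$$ Then $\alpha$ has arity $0\to2$, $\beta$ has arity $2\to0$, and $(\alpha,\beta)$ is a duality: $$\alpha^\bullet\circ B=(B\,\alpha)\circ B^2,\qquad \beta^\bullet\circ B^3=B\,\beta,\qquad \alpha\circ(B\,\beta)=B\,I,\qquad (B\,\alpha)\circ\beta=B\,I.$$ -/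

import Mathlib

universe u

namespace CombAlg

/-- An applicative structure: a set with a binary application. -/
class ApplicativeStructure (A : Type u) where
  app : A → A → A

/-- Application, associating to the left. -/
infixl:100 " ⬝ " => ApplicativeStructure.app

/-- The bare data of an applicative structure with two distinguished elements `B` and `I`.
The laws are imposed in the classes below. -/
class BIStructure (A : Type u) extends ApplicativeStructure A where
  B : A
  I : A

open BIStructure

/-- `a ∘ b` abbreviates `B a b`. -/
def comp {A : Type u} [BIStructure A] (a b : A) : A := B ⬝ a ⬝ b

infixr:80 " ⊚ " => comp

/-- Iterated composition: `a ^ 0 = I` and `a ^ (n + 1) = a ∘ a ^ n`. -/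
def cpow {A : Type u} [BIStructure A] (a : A) : ℕ → A
  | 0 => I
  | n + 1 => a ⊚ cpow a n

/-- `BI(_)•`-algebras; `bul a` is `a•`. -/
class BIBulAlgebra (A : Type u) extends BIStructure A where
  bul : A → A
  B_app : ∀ a b c : A, B ⬝ a ⬝ b ⬝ c = a ⬝ (b ⬝ c)
  I_app : ∀ a : A, I ⬝ a = a
  bul_app : ∀ a b : A, bul a ⬝ b = b ⬝ a

open BIBulAlgebra

/-- Extensional `BI(_)•`-algebras. -/
class ExtBIBulAlgebra (A : Type u) extends BIBulAlgebra A where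
  BI : B ⬝ I = (I : A)
  bul_of_app : ∀ a b : A, bul (a ⬝ b) = bul b ⊚ (bul a ⊚ B)
  arity_B : bul (B : A) ⊚ (B ⊚ (B ⊚ B)) = (B ⬝ B) ⊚ B
  arity_I : bul (I : A) ⊚ B = B ⬝ I
  arity_bul : ∀ a : A, bul (bul a) ⊚ B = (B ⬝ bul a) ⊚ B

/-- `a` is of arity `m → n`. -/
def HasArity {A : Type u} [ExtBIBulAlgebra A] (a : A) (m n : ℕ) : Prop :=
  bul a ⊚ cpow B (m + 1) = (B ⬝ a) ⊚ cpow B n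

/-- The pair `(α, β)` is a duality in an extensional `BI(_)•`-algebra. -/
structure IsDuality {A : Type u} [ExtBIBulAlgebra A] (α β : A) : Prop where
  arity_α : bul α ⊚ B = (B ⬝ α) ⊚ cpow B 2
  arity_β : bul β ⊚ cpow B 3 = B ⬝ β
  duality₁ : α ⊚ (B ⬝ β) = B ⬝ I
  duality₂ : (B ⬝ α) ⊚ β = B ⬝ I

/-- The two signs `+` and `-`, used as indices of `C⁺`, `C⁻`, `θ⁺`, `θ⁻`. -/
inductive Sgn : Type
  | pos : Sgn
  | neg : Sgn

/-- The opposite sign. -/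
def Sgn.opp : Sgn → Sgn
  | .pos => .neg
  | .neg => .pos

/-- Extensional `BC±I`-algebras; `C .pos` is `C⁺` and `C .neg` is `C⁻`.
The sign `s` below is a linked sign (with `s.opp` the opposite one);
the signs `t`, `t'` are arbitrary choices. -/
class ExtBCIAlgebra (A : Type u) extends BIStructure A where
  C : Sgn → A
  B_app : ∀ a b c : A, B ⬝ a ⬝ b ⬝ c = a ⬝ (b ⬝ c)
  C_app : ∀ (t : Sgn) (a b c : A), C t ⬝ a ⬝ b ⬝ c = a ⬝ c ⬝ b
  I_app : ∀ a : A, I ⬝ a = a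
  C2 : ∀ a b : A, C .pos ⬝ a ⬝ b = C .neg ⬝ a ⬝ b
  law_lambda : B ⬝ I = (I : A)
  law_rho : ∀ t : Sgn, C t ⬝ B ⬝ I = B ⬝ I
  law_alpha : ∀ t : Sgn, (C t ⬝ B ⬝ B) ⊚ (B ⊚ B) = (B ⬝ B) ⊚ B
  cox₁ : ∀ s : Sgn, C s ⊚ C s.opp = B ⬝ (B ⬝ I)
  cox₂ : ∀ t s : Sgn, (C t ⬝ B ⬝ C s) ⊚ (B ⊚ B) = (B ⬝ C s) ⊚ (B ⊚ B)
  cox₃ : ∀ s : Sgn, (B ⬝ C s) ⊚ (C s ⊚ (B ⬝ C s)) = C s ⊚ ((B ⬝ C s) ⊚ C s)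
  law_bc : ∀ s : Sgn, (B ⬝ B) ⊚ C s = C s ⊚ ((B ⬝ C s) ⊚ B)

namespace ExtBCIAlgebra

variable {A : Type u} [ExtBCIAlgebra A]

theorem comp_app (a b c : A) : (a ⊚ b) ⬝ c = a ⬝ (b ⬝ c) := B_app a b c

theorem C_sgn (s t : Sgn) (a b : A) : C s ⬝ a ⬝ b = C t ⬝ a ⬝ b := by
  cases s <;> cases t <;> simp [C2]

theorem I_comp (a : A) : I ⊚ a = a := by
  rw [comp, law_lambda, I_app]

theorem C_B (t : Sgn) (a f : A) : C t ⬝ B ⬝ a ⬝ f = f ⊚ a := C_app t B a f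

theorem comp_I (a : A) : a ⊚ I = a := by
  rw [← C_B .pos, law_rho, law_lambda, I_app]

theorem B_comp (a b : A) : B ⬝ (a ⊚ b) = (B ⬝ a) ⊚ (B ⬝ b) := by
  have h := congrArg (fun x : A => x ⬝ a ⬝ b) (law_alpha (A := A) .pos)
  simp only [comp_app, C_B, B_app] at h
  exact h.symm

theorem comp_assoc (a b c : A) : (a ⊚ b) ⊚ c = a ⊚ (b ⊚ c) := by
  have h := congrArg (fun x : A => x ⬝ c) (B_comp a b)
  simp only [comp_app] at h
  exact h

theorem B_comp_C (s : Sgn) (f : A) : B ⊚ (C s ⬝ f) = C s ⬝ (C s ⊚ (B ⬝ f)) := by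
  have h := congrArg (fun x : A => x ⬝ f) (law_bc (A := A) s)
  simp only [comp_app] at h
  exact h

theorem C_eq (s t : Sgn) (a b : A) : C s ⬝ a ⬝ b = (C t ⬝ I ⬝ b) ⊚ a := by
  have h := congrArg (fun x : A => x ⬝ b ⬝ a) (B_comp_C t (I : A))
  simp only [comp_app, C_app, law_lambda, I_app] at h
  rw [C_sgn s t]
  exact h.symm

theorem C_B_eq (t : Sgn) (x b : A) : C t ⬝ (B ⬝ x) ⬝ b = x ⊚ (C t ⬝ I ⬝ b) := by
  have h := congrArg (fun y : A => y ⬝ x ⬝ I ⬝ b) (cox₂ (A := A) .pos t)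
  simp only [comp_app, C_B] at h
  have hI : B ⬝ (B ⬝ x) ⬝ I = B ⬝ x := comp_I _
  rw [B_app, B_app (C t), hI] at h
  exact h.symm

theorem C_inv (s : Sgn) (x : A) : C s.opp ⊚ (C s ⊚ x) = x := by
  have h := cox₁ (A := A) s.opp
  have h' : s.opp.opp = s := by cases s <;> rfl
  rw [h', law_lambda, law_lambda] at h
  rw [← comp_assoc, h, I_comp]

/-- The element `a•` of an extensional `BC±I`-algebra (the choice of the sign is irrelevant). -/
def bullet (a : A) : A := C .pos ⬝ I ⬝ a

theorem bullet_eq (t : Sgn) (a : A) : bullet a = C t ⬝ I ⬝ a := C_sgn _ _ _ _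

theorem bullet_comp (t : Sgn) (a b : A) : bullet b ⊚ a = C t ⬝ a ⬝ b := (C_eq t .pos a b).symm

theorem bullet_comp_B (x b : A) : bullet b ⊚ (B ⬝ x) = x ⊚ bullet b := by
  rw [bullet_comp .pos, C_B_eq]; rfl

theorem B_bullet (a : A) : B ⬝ bullet a = bullet a ⊚ C .pos := by
  have h := congrArg (fun x : A => x ⬝ a) (B_comp_C .pos (I : A))
  simp only [comp_app, law_lambda, comp_I] at h
  rw [bullet_comp .pos]
  exact h

theorem bullet_app (a b : A) : bullet (a ⬝ b) = bullet b ⊚ (bullet a ⊚ B) := by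
  have h := law_bc (A := A) .pos
  have h2 : C .neg ⊚ (C .neg ⬝ B) = B ⬝ (C .neg ⬝ (I : A)) := by
    have h3 : C .neg ⊚ ((B ⬝ B) ⊚ C .pos) = (B ⬝ C .pos) ⊚ (B : A) := by
      rw [h]; exact C_inv .pos _
    have h4 := congrArg (fun x : A => (x ⊚ C .neg) ⬝ I) h3
    have h5 : (C .pos : A) ⊚ C .neg = I := by
      rw [show (C .neg : A) = C (Sgn.opp .pos) from rfl, cox₁, law_lambda, law_lambda]
    simp only [comp_assoc, h5, comp_I] at h4
    simp only [comp_app] at h4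
    change C .neg ⬝ (B ⊚ I) = C .pos ⊚ (B ⬝ (C .neg ⬝ I)) at h4
    rw [comp_I] at h4
    rw [h4]
    exact C_inv .pos _
  have h6 := congrArg (fun x : A => x ⬝ a ⬝ b) h2
  simp only [comp_app, B_app] at h6
  rw [bullet_comp .neg, bullet_comp .neg, bullet_eq .neg, h6]

theorem bullet_bullet (a : A) : bullet (bullet a) ⊚ B = (B ⬝ bullet a) ⊚ B := by
  have hI : bullet (I : A) ⊚ B = I := by rw [bullet_comp .pos, law_rho, law_lambda]
  have h1 : bullet (bullet a) ⊚ (B : A)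
      = bullet a ⊚ (bullet I ⊚ ((bullet (C .pos) ⊚ B) ⊚ (B ⊚ B))) := by
    conv_lhs => rw [bullet, bullet, ← bullet, bullet_app, bullet_app]
    simp only [comp_assoc]
  rw [h1, bullet_comp .pos B (C .pos), cox₂, ← comp_assoc (bullet I), bullet_comp_B, B_bullet,
    comp_assoc, ← comp_assoc (bullet I), hI, I_comp, comp_assoc]

end ExtBCIAlgebra

/-- Every extensional `BC±I`-algebra is an extensional `BI(_)•`-algebra with `a• = C⁺ I a`. -/
instance ExtBCIAlgebra.toExtBIBulAlgebra (A : Type u) [ExtBCIAlgebra A] : ExtBIBulAlgebra A where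
  bul := ExtBCIAlgebra.bullet
  B_app := ExtBCIAlgebra.B_app
  I_app := ExtBCIAlgebra.I_app
  bul_app a b := by
    rw [ExtBCIAlgebra.bullet, ExtBCIAlgebra.C_app, ExtBCIAlgebra.I_app]
  BI := ExtBCIAlgebra.law_lambda
  bul_of_app := ExtBCIAlgebra.bullet_app
  arity_B := by
    rw [← ExtBCIAlgebra.comp_assoc, ExtBCIAlgebra.bullet_comp .pos, ExtBCIAlgebra.law_alpha]
  arity_I := by
    rw [ExtBCIAlgebra.bullet_comp .pos, ExtBCIAlgebra.law_rho]
  arity_bul := ExtBCIAlgebra.bullet_bullet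

open ExtBCIAlgebra (C)

/-- Balanced extensional `BC±I`-algebras; `θ .pos` is `θ⁺` and `θ .neg` is `θ⁻`. -/
class BalancedExtBCIAlgebra (A : Type u) extends ExtBCIAlgebra A where
  θ : Sgn → A
  theta₁ : ∀ t s : Sgn, (B ⬝ θ s) ⊚ B = (C t ⬝ B ⬝ θ s) ⊚ B
  theta₂ : ∀ s : Sgn, θ s ⊚ θ s.opp = B ⬝ I
  theta₃ : ∀ (t s t' : Sgn) (a : A), C t ⬝ θ s ⬝ a = C t' ⬝ I ⬝ a
  theta₄ : ∀ s : Sgn, B ⊚ θ s = θ s ⊚ C s ⊚ θ s ⊚ C s ⊚ B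

open BalancedExtBCIAlgebra (θ)

/-- Traced balanced extensional `BC±I`-algebras. -/
class TracedExtBCIAlgebra (A : Type u) extends BalancedExtBCIAlgebra A where
  Tr : A
  left_tightening : ∀ t : Sgn, (C t ⬝ B ⬝ Tr) ⊚ B = (B ⬝ Tr) ⊚ cpow B 2
  right_tightening : ∀ t : Sgn, (B ⬝ Tr) ⊚ (C t ⬝ B ⬝ B) ⊚ B = B ⊚ Tr
  yanking : ∀ s : Sgn, Tr ⬝ C s = θ s
  exchange : ∀ t : Sgn,
    cpow Tr 2 ⊚ (C t ⬝ B ⬝ C .neg) ⊚ (B ⬝ C .pos) = cpow Tr 2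

open TracedExtBCIAlgebra (Tr)

/-- `Tr (Tr ∘ (B Tr) ∘ (B C⁺) ∘ C⁺)`. -/
def dualUnit (A : Type u) [TracedExtBCIAlgebra A] : A :=
  Tr ⬝ (Tr ⊚ (B ⬝ Tr) ⊚ (B ⬝ C .pos) ⊚ C .pos)

/-- `Tr (C⁺ ∘ (B C⁺) ∘ (B B) ∘ B)`. -/
def dualCounit (A : Type u) [TracedExtBCIAlgebra A] : A :=
  Tr ⬝ (C .pos ⊚ (B ⬝ C .pos) ⊚ (B ⬝ B) ⊚ B)

end CombAlg

/-! Read `⊚` as composition of string diagrams, `B ⬝ x` as `x` with an extra strand beside it, `C`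
as a braiding, `θ` as a twist and `Tr ⬝ x` as the closure of a strand into a loop. Left tightening
says that `Tr` itself has arity 1 → 2, so it can be braided and traced like any other diagram; the
arities of α and β are then bookkeeping. For the zigzags, β is absorbed into `Tr ⊚ C .pos`
(`Tr_comp_C_comp_dualCounit`) and α into a braided application (`B_dualUnit_comp_C_comp_B`). Both
composites thereby become the same trace, evaluated in `Tr_zigzag`: it arises by sliding `Tr ⊚ C
.neg` around a loop (`Tr_slide`), and the unslid form collapses by superposing (`Tr_conj_C`).
Superposing is not an axiom. It follows from an expansion of `Tr` (`Tr_eq_eta`), which is checked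
after composing with `B ⬝ B`, where yanking applies; `eq_of_comp_B_B` cancels that factor. -/

namespace CombAlg

open BIStructure

/-! ### Identities between `B`, `C` and bullets. -/

namespace ExtBCIAlgebra

variable {A : Type u} [ExtBCIAlgebra A]

/-- Composites are kept nested to the right, so an identity needs an arbitrary tail `k` before it
can rewrite inside a longer composite. -/
theorem tail₂ {a b r : A} (h : a ⊚ b = r) (k : A) : a ⊚ b ⊚ k = r ⊚ k := by
  rw [← h]; simp only [comp_assoc]

theorem tail₃ {a b c r : A} (h : a ⊚ b ⊚ c = r) (k : A) : a ⊚ b ⊚ c ⊚ k = r ⊚ k := by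
  rw [← h]; simp only [comp_assoc]

theorem tail₄ {a b c d r : A} (h : a ⊚ b ⊚ c ⊚ d = r) (k : A) :
    a ⊚ b ⊚ c ⊚ d ⊚ k = r ⊚ k := by
  rw [← h]; simp only [comp_assoc]

theorem B_natural (x : A) : B ⊚ (B ⬝ x) = (B ⬝ (B ⬝ x)) ⊚ B := by
  have h := congrArg (fun y : A => y ⬝ x) (law_alpha (A := A) .pos)
  simp only [comp_app, C_B] at h
  exact h.symm

theorem C_natural (s : Sgn) (x : A) : C s ⊚ (B ⬝ (B ⬝ x)) = (B ⬝ (B ⬝ x)) ⊚ C s := by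
  have h := congrArg (fun y : A => y ⬝ x) (cox₂ (A := A) .pos s)
  simp only [comp_app, C_B] at h
  exact h.symm

theorem C_comp_opp (s : Sgn) : C s ⊚ C s.opp = (I : A) := by
  rw [cox₁, law_lambda, law_lambda]

theorem C_opp_comp (s : Sgn) : C s.opp ⊚ C s = (I : A) := by
  have h := C_inv s (I : A)
  rwa [comp_I] at h

theorem bullet_C (s : Sgn) (a : A) : bullet a ⊚ C s = B ⬝ bullet a := by
  have h := congrArg (fun x : A => x ⬝ a) (B_comp_C s (I : A))
  simp only [comp_app, law_lambda, comp_I] at h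
  rw [bullet_comp s, bullet_eq s]
  exact h.symm

theorem B_comp_C_eq (s : Sgn) : B ⊚ C s = (B ⬝ C s) ⊚ C s ⊚ ((B : A) ⬝ B) := by
  have h := law_bc (A := A) s.opp
  have h1 : ((B : A) ⬝ B) = C s.opp ⊚ (B ⬝ C s.opp) ⊚ B ⊚ C s := by
    rw [← comp_I ((B : A) ⬝ B), ← C_opp_comp s, tail₂ h]
    simp only [comp_assoc]
  rw [h1, tail₂ (C_comp_opp s), I_comp, ← comp_assoc, ← B_comp, C_comp_opp, law_lambda, I_comp]

theorem C_comp_B_B (s : Sgn) : C s ⊚ ((B : A) ⬝ B) = (B ⬝ C s.opp) ⊚ B ⊚ C s := by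
  rw [B_comp_C_eq, ← comp_assoc (B ⬝ _), ← B_comp, C_opp_comp, law_lambda, I_comp]

theorem B_C_comp_B (s : Sgn) : ((B : A) ⬝ C s) ⊚ B = C s.opp ⊚ (B ⬝ B) ⊚ C s := by
  rw [law_bc, tail₂ (C_opp_comp s), I_comp]

theorem bullet_I_comp_B : bullet (I : A) ⊚ B = I := by
  rw [bullet_comp .pos, law_rho, law_lambda]

theorem bullet_comp_eq (x y : A) : bullet (x ⊚ y) = bullet y ⊚ bullet x ⊚ bullet B ⊚ B ⊚ B := by
  rw [comp, bullet_app, bullet_app]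
  simp only [comp_assoc]

theorem bullet_B_arity : bullet (B : A) ⊚ B ⊚ B ⊚ B = (B ⬝ B) ⊚ B := by
  rw [← comp_assoc, bullet_comp .pos, law_alpha]

theorem bullet_C_arity (s : Sgn) :
    bullet (C s : A) ⊚ B ⊚ B ⊚ B = (B ⬝ C s) ⊚ B ⊚ B := by
  rw [← comp_assoc, bullet_comp .pos, cox₂]

theorem B_bullet_I_comp : (B ⬝ bullet (I : A)) ⊚ bullet B ⊚ B ⊚ B = I := by
  have h : bullet (bullet (I : A) ⊚ B) ⊚ B = I := by
    rw [bullet_I_comp_B, bullet_I_comp_B]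
  rw [bullet_comp_eq] at h
  simp only [comp_assoc] at h
  rw [bullet_B_arity, tail₂ (bullet_comp_B _ _), comp_assoc, bullet_bullet,
    tail₂ (B_natural _), comp_assoc, tail₂ (bullet_comp_B _ _), comp_assoc] at h
  exact h

theorem cpow_B_apply_I (n : ℕ) : cpow (B : A) n ⬝ I = I := by
  induction n with
  | zero => exact I_app _
  | succ n ih => rw [cpow, comp_app, ih, law_lambda]

theorem cpow_succ_right (a : A) (n : ℕ) : cpow a (n + 1) = cpow a n ⊚ a := by
  induction n with
  | zero => rw [cpow, cpow, cpow, comp_I, I_comp]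
  | succ n ih => rw [cpow, ih, ← comp_assoc, ← ih]; rfl

theorem hasArity_iff {a : A} {m n : ℕ} :
    HasArity a m n ↔ bullet a ⊚ cpow B (m + 1) = (B ⬝ a) ⊚ cpow B n := Iff.rfl

end ExtBCIAlgebra

open ExtBCIAlgebra

/-! ### Calculus of arities. -/

namespace HasArity

variable {A : Type u} [ExtBCIAlgebra A] {x y : A} {m n p : ℕ}

theorem weaken (h : HasArity x m n) : HasArity x (m + 1) (n + 1) := by
  rw [hasArity_iff] at *
  rw [cpow_succ_right, ← comp_assoc, h, comp_assoc, ← cpow_succ_right]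

theorem lift (h : HasArity x m n) : HasArity (B ⬝ x) (m + 1) (n + 1) := by
  rw [hasArity_iff] at *
  rw [bullet_app]
  simp only [cpow, comp_assoc] at h ⊢
  rw [tail₄ bullet_B_arity, comp_assoc, tail₂ (bullet_comp_B _ _), comp_assoc, h,
    tail₂ (B_natural _), comp_assoc]

theorem comp (hx : HasArity x m n) (hy : HasArity y n p) : HasArity (x ⊚ y) m p := by
  rw [hasArity_iff] at *
  rw [bullet_comp_eq, B_comp]
  simp only [cpow, comp_assoc] at hx hy ⊢
  rw [tail₄ bullet_B_arity, comp_assoc, tail₂ (bullet_comp_B _ _), comp_assoc, hx,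
    tail₂ (B_natural _), comp_assoc, tail₂ (bullet_comp_B _ _), comp_assoc, hy]

theorem of_bullet (a : A) : HasArity (bullet a) 0 1 := by
  rw [hasArity_iff]
  simp only [cpow, comp_I]
  exact bullet_bullet a

theorem of_B : HasArity (B : A) 2 1 := by
  rw [hasArity_iff]
  simp only [cpow, comp_I]
  exact bullet_B_arity

theorem of_C (s : Sgn) : HasArity (C s : A) 2 2 := by
  rw [hasArity_iff]
  simp only [cpow, comp_I]
  exact bullet_C_arity s

theorem apply (h : HasArity x m n) (a : A) :
    x ⊚ (cpow B n ⬝ a) = (cpow B (m + 1) ⬝ a) ⬝ x := by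
  have h := congrArg (fun y : A => y ⬝ a) (hasArity_iff.1 h)
  simp only [comp_app] at h
  rw [bullet, C_app, I_app] at h
  exact h.symm

theorem natural₁₁ (h : HasArity x 1 1) (a : A) : x ⊚ (B ⬝ a) = (B ⬝ a) ⊚ x := by
  have h := h.apply a
  simp only [cpow, comp_I, comp_app] at h
  exact h

theorem natural₁₂ (h : HasArity x 1 2) (a : A) : x ⊚ (B ⬝ (B ⬝ a)) = (B ⬝ a) ⊚ x := by
  have h := h.apply a
  simp only [cpow, comp_I, comp_app] at h
  exact h

/-- Hence an element of arity 1 → 1 is determined by its value at `I`. -/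
theorem eq_of_arity₁₁ (h : HasArity x 1 1) : x = bullet (x ⬝ I) ⊚ B := by
  rw [hasArity_iff] at h
  simp only [cpow, comp_I] at h
  rw [bullet_app]
  simp only [comp_assoc]
  rw [h, tail₂ (bullet_comp_B _ _), comp_assoc, bullet_I_comp_B, comp_I]

end HasArity

/-! ### Naturality of the braiding. -/

namespace ExtBCIAlgebra

variable {A : Type u} [ExtBCIAlgebra A]

/-- Equality can be tested after applying to data on the left of the braided strand. -/
theorem eq_of_C_comp {s : Sgn} {n : ℕ} {x y : A}
    (h : C s ⊚ (B ⬝ x) ⊚ cpow B n = C s ⊚ (B ⬝ y) ⊚ cpow B n) : x = y := by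
  have h1 : (B ⬝ x) ⊚ cpow B n = (B ⬝ y) ⊚ cpow B n := by
    rw [← C_inv s ((B ⬝ x) ⊚ cpow B n), h, C_inv]
  -- Powers of `B` fix `I`, so evaluation at `I` leaves `x ⊚ I` and `y ⊚ I`.
  have h2 := congrArg (fun z : A => z ⬝ I) h1
  simp only [comp_app, cpow_B_apply_I] at h2
  exact (comp_I x).symm.trans (h2.trans (comp_I y))

/-- A strand braided past the arguments of an iterated application. -/
theorem C_comp_cpow_three (s : Sgn) :
    C s ⊚ (B ⬝ C s) ⊚ (B ⬝ (B ⬝ C s)) ⊚ cpow B 3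
      = ((B : A) ⬝ B) ⊚ (B ⬝ B) ⊚ C s ⊚ B := by
  simp only [cpow, comp_I]
  rw [tail₂ (B_natural _).symm, comp_assoc]
  have h : C s ⊚ (B ⬝ C s) ⊚ B = ((B : A) ⬝ B) ⊚ C s := (law_bc s).symm
  rw [tail₃ h, comp_assoc, tail₃ h]
  simp only [comp_assoc]

theorem C_comp_bullet_comp_B (s : Sgn) (a k : A) :
    C s ⊚ bullet a ⊚ B ⊚ k = (B ⬝ bullet a) ⊚ (B ⬝ B) ⊚ C s ⊚ k := by
  rw [tail₂ (bullet_comp_B _ _).symm, comp_assoc, tail₂ (B_C_comp_B s)]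
  simp only [comp_assoc]
  rw [tail₂ (bullet_C _ _)]

theorem C_comp_of_arity₁₁ (s : Sgn) {g : A} (h : HasArity g 1 1) : C s ⊚ g = (B ⬝ g) ⊚ C s := by
  have h1 := C_comp_bullet_comp_B s (g ⬝ I) I
  rw [comp_I, comp_I, ← h.eq_of_arity₁₁, ← comp_assoc (B ⬝ _), ← B_comp, ← h.eq_of_arity₁₁] at h1
  exact h1

/-- Once enough factors `B` follow, the arity equation trades `B ⬝ g` for `bullet g`, and a bullet
crosses the braiding by `C_comp_bullet_comp_B`. -/
theorem C_comp_of_arity₁₂ (s : Sgn) {g : A} (h : HasArity g 1 2) :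
    C s ⊚ g = (B ⬝ g) ⊚ C s ⊚ (B ⬝ C s) := by
  apply eq_of_C_comp (s := s) (n := 3)
  have hg : bullet g ⊚ B ⊚ B = (B ⬝ g) ⊚ B ⊚ B := by
    have h := hasArity_iff.1 h
    simpa only [cpow, comp_I] using h
  simp only [B_comp, comp_assoc]
  rw [tail₂ (C_natural _ _), comp_assoc, C_comp_cpow_three]
  simp only [cpow, comp_I]
  rw [tail₃ hg.symm]
  simp only [comp_assoc]
  rw [tail₂ (bullet_comp_B _ _).symm, comp_assoc, tail₂ (B_natural _).symm,
    comp_assoc, C_comp_bullet_comp_B, tail₃ (law_bc s).symm]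
  simp only [comp_assoc]
  have hg' := congrArg (fun z : A => B ⬝ z) hg
  simp only [B_comp] at hg'
  rw [tail₃ hg']
  simp only [comp_assoc]

theorem C_comp_of_arity₀₂ (s : Sgn) {g : A} (h : HasArity g 0 2) :
    g = (B ⬝ g) ⊚ C s ⊚ (B ⬝ C s) := by
  apply eq_of_C_comp (s := s) (n := 3)
  have hg : bullet g ⊚ B = (B ⬝ g) ⊚ B ⊚ B := by
    have h := hasArity_iff.1 h
    simpa only [cpow, comp_I] using h
  simp only [B_comp, comp_assoc]
  rw [tail₂ (C_natural _ _), comp_assoc, C_comp_cpow_three]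
  simp only [cpow, comp_I]
  rw [tail₃ hg.symm]
  simp only [comp_assoc]
  rw [C_comp_bullet_comp_B]
  have hg' := congrArg (fun z : A => B ⬝ z) hg
  simp only [B_comp] at hg'
  rw [tail₂ hg']
  simp only [comp_assoc]

theorem C_comp_B_of_arity₁₂ (s : Sgn) {g : A} (h : HasArity g 1 2) :
    C s ⊚ (B ⬝ g) = g ⊚ (B ⬝ C s) ⊚ C s := by
  have h1 := C_comp_of_arity₁₂ s.opp h
  rw [← C_inv s.opp (g ⊚ _), tail₂ h1]
  have h' : s.opp.opp = s := by cases s <;> rfl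
  simp only [comp_assoc]
  rw [h', ← comp_assoc (B ⬝ C s.opp), ← B_comp, C_opp_comp, law_lambda, I_comp, C_opp_comp, comp_I]

theorem bullet_comp_B_B_comp_C (s : Sgn) (a : A) :
    bullet a ⊚ B ⊚ B ⊚ C s
      = (B ⬝ C s) ⊚ C s ⊚ (B ⬝ bullet a) ⊚ (B ⬝ B) ⊚ (B ⬝ B) := by
  rw [B_comp_C_eq, tail₂ (B_natural _), comp_assoc, tail₂ (B_comp_C_eq s)]
  simp only [comp_assoc]
  rw [tail₂ (bullet_comp_B _ _), comp_assoc, tail₂ (bullet_comp_B _ _), comp_assoc,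
    tail₂ (bullet_C _ _)]

/-- The Yang–Baxter relation. -/
theorem yang_baxter (s : Sgn) :
    ((B : A) ⬝ C s) ⊚ C s ⊚ (B ⬝ C s) = C s ⊚ (B ⬝ C s) ⊚ C s := cox₃ s

end ExtBCIAlgebra

open BalancedExtBCIAlgebra TracedExtBCIAlgebra

/-! ### Twists. -/

namespace BalancedExtBCIAlgebra

variable {A : Type u} [BalancedExtBCIAlgebra A]

theorem hasArity_θ (s : Sgn) : HasArity (θ s : A) 1 1 := by
  have h := theta₁ (A := A) .pos s
  rw [← bullet_comp .pos, comp_assoc] at h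
  rw [hasArity_iff]
  simp only [cpow, comp_I]
  exact h.symm

theorem θ_pos_neg : θ .pos ⊚ θ .neg = (I : A) :=
  (theta₂ (A := A) .pos).trans law_lambda

theorem θ_neg_pos : θ .neg ⊚ θ .pos = (I : A) :=
  (theta₂ (A := A) .neg).trans law_lambda

theorem C_pos_neg : C .pos ⊚ C .neg = (I : A) := C_comp_opp .pos

theorem C_neg_pos : C .neg ⊚ C .pos = (I : A) := C_comp_opp .neg

theorem θ_natural (s : Sgn) (x : A) : θ s ⊚ (B ⬝ x) = (B ⬝ x) ⊚ θ s := (hasArity_θ s).natural₁₁ x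

theorem C_comp_θ (s t : Sgn) : C s ⊚ θ t = ((B : A) ⬝ θ t) ⊚ C s :=
  C_comp_of_arity₁₁ s (hasArity_θ t)

end BalancedExtBCIAlgebra

/-! ### Traces: yanking, superposing and sliding. -/

namespace TracedExtBCIAlgebra

variable {A : Type u} [TracedExtBCIAlgebra A]

theorem hasArity_Tr : HasArity (Tr : A) 1 2 := by
  have h := left_tightening (A := A) .pos
  rw [← bullet_comp .pos, comp_assoc] at h
  rw [hasArity_iff]
  simp only [cpow, comp_I] at h ⊢
  exact h

theorem Tr_natural (x : A) : Tr ⊚ (B ⬝ (B ⬝ x)) = (B ⬝ x) ⊚ Tr := hasArity_Tr.natural₁₂ x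

theorem Tr_B_comp (a x : A) : Tr ⬝ ((B ⬝ a) ⊚ x) = a ⊚ (Tr ⬝ x) := by
  have h := congrArg (fun y : A => y ⬝ a ⬝ x) (left_tightening (A := A) .pos)
  simp only [comp_app, C_B, B_app, cpow, comp_I] at h
  exact h.symm

theorem Tr_comp_B (x a : A) : Tr ⬝ (x ⊚ (B ⬝ a)) = (Tr ⬝ x) ⊚ a := by
  have h := congrArg (fun y : A => y ⬝ x ⬝ a) (right_tightening (A := A) .pos)
  simp only [comp_app, C_B, B_app] at h
  exact h

theorem B_comp_Tr : B ⊚ Tr = ((B : A) ⬝ Tr) ⊚ bullet B ⊚ B ⊚ B := by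
  rw [← right_tightening .pos, ← bullet_comp .pos]
  simp only [comp_assoc]

theorem B_Tr (x : A) : B ⬝ (Tr ⬝ x) = Tr ⊚ (B ⬝ x) ⊚ B := by
  have h := congrArg (fun y : A => y ⬝ x) (right_tightening (A := A) .pos)
  simp only [comp_app, C_B] at h
  exact h.symm

/-- Turns the argument of a trace into a factor of a composite. -/
theorem Tr_eq (x : A) : Tr ⬝ x = bullet I ⊚ Tr ⊚ (B ⬝ x) ⊚ B ⊚ B := by
  have h := tail₂ (bullet_comp_B (Tr ⬝ x) (I : A)) B
  rw [comp_assoc, bullet_I_comp_B, comp_I, B_Tr] at h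
  rw [← h]
  simp only [comp_assoc]

theorem Tr_exchange (x : A) : Tr ⬝ (Tr ⬝ (C .pos ⊚ x ⊚ C .neg)) = Tr ⬝ (Tr ⬝ x) := by
  have h := congrArg (fun y : A => y ⬝ x) (exchange (A := A) .pos)
  simp only [comp_app, cpow, comp_I] at h
  rw [C_B] at h
  change Tr ⬝ (Tr ⬝ ((C .pos ⊚ x) ⊚ C .neg)) = _ at h
  rw [comp_assoc] at h
  exact h

theorem Tr_C_pos : Tr ⬝ C .pos = (θ .pos : A) := yanking .pos

theorem Tr_C_neg : Tr ⬝ C .neg = (θ .neg : A) := yanking .neg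

theorem hasArity_Tr_app {x : A} {m n : ℕ} (h : HasArity x (m + 1) (n + 1)) :
    HasArity (Tr ⬝ x) m n := by
  have hT := hasArity_iff.1 (hasArity_Tr (A := A))
  rw [hasArity_iff] at *
  rw [bullet_app, B_Tr]
  simp only [cpow, comp_assoc, comp_I] at *
  rw [tail₃ hT]
  simp only [comp_assoc]
  rw [tail₂ (bullet_comp_B _ _), comp_assoc, h]

/-- Yanking of a loop whose output is applied to a further argument. -/
theorem Tr_comp_C_comp (s : Sgn) :
    Tr ⊚ C s ⊚ ((B : A) ⬝ B) = (B ⬝ θ s.opp) ⊚ C s := by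
  rw [C_comp_B_B, ← yanking, B_Tr]
  simp only [comp_assoc]

theorem Tr_comp_C_neg_comp : Tr ⊚ C .neg ⊚ ((B : A) ⬝ B) = (B ⬝ θ .pos) ⊚ C .neg :=
  Tr_comp_C_comp .neg

theorem Tr_comp_C_pos_comp : Tr ⊚ C .pos ⊚ ((B : A) ⬝ B) = (B ⬝ θ .neg) ⊚ C .pos :=
  Tr_comp_C_comp .pos

/-- Applying a strand to the second leg of a cup and abstracting the first leg gives the
identity. -/
theorem eta_section :
    (B ⬝ (bullet (I : A) ⊚ Tr ⊚ C .pos ⊚ θ .pos)) ⊚ B ⊚ bullet B ⊚ B ⊚ bullet B ⊚ B ⊚ B = I := by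
  have h1 : bullet (I : A) ⊚ Tr ⊚ C .pos ⊚ θ .pos ⊚ (B ⬝ B) = B ⬝ bullet I := by
    rw [θ_natural, tail₃ Tr_comp_C_pos_comp, comp_assoc, tail₂ (bullet_comp_B _ _), comp_assoc,
      tail₂ (bullet_C _ _), ← θ_natural, tail₂ θ_neg_pos, I_comp]
  have h2 : ((B ⬝ (bullet (I : A) ⊚ Tr ⊚ C .pos ⊚ θ .pos))
      ⊚ B ⊚ bullet B ⊚ B ⊚ bullet B ⊚ B ⊚ B) ⊚ B = B := by
    simp only [comp_assoc]
    rw [bullet_B_arity, tail₂ (B_natural _), comp_assoc, tail₂ (bullet_comp_B _ _), comp_assoc,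
      tail₂ (B_natural _), comp_assoc, ← comp_assoc (B ⬝ _) (B ⬝ _), ← B_comp]
    simp only [comp_assoc]
    rw [h1, tail₂ (B_natural _).symm, comp_assoc, B_bullet_I_comp, comp_I]
  have h3 : HasArity ((B ⬝ (bullet (I : A) ⊚ Tr ⊚ C .pos ⊚ θ .pos))
      ⊚ B ⊚ bullet B ⊚ B ⊚ bullet B ⊚ B ⊚ B) 1 1 :=
    (((HasArity.of_bullet _).comp (hasArity_Tr.comp ((HasArity.of_C _).comp
      (hasArity_θ _).weaken))).lift).comp
    (HasArity.of_B.weaken.comp ((HasArity.of_bullet B).weaken.weaken.comp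
    (HasArity.of_B.weaken.comp ((HasArity.of_bullet B).weaken.weaken.comp
    (HasArity.of_B.weaken.comp HasArity.of_B)))))
  -- As `B ⬝ I = I`, the element fixes `I`; having arity 1 → 1, it is then `I`.
  have h4 := congrArg (fun y : A => y ⬝ I) h2
  rw [comp_app, law_lambda] at h4
  rw [h3.eq_of_arity₁₁, h4, bullet_I_comp_B]

/-- In `eta_section` the outer factor `B ⬝ _` commutes past an element of arity 1 → 2, which
recovers that element from its composite with `B ⬝ B`. -/
theorem eq_of_comp_B_B {x y : A} (hx : HasArity x 1 2) (hy : HasArity y 1 2)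
    (h : x ⊚ (B ⬝ B) = y ⊚ (B ⬝ B)) : x = y := by
  have key : ∀ z : A, HasArity z 1 2 →
      z = (B ⬝ (bullet (I : A) ⊚ Tr ⊚ C .pos ⊚ θ .pos)) ⊚ (z ⊚ (B ⬝ B)) ⊚
        (B ⬝ (bullet B ⊚ B ⊚ bullet B ⊚ B ⊚ B)) := by
    intro z hz
    have e := congrArg (fun w : A => z ⊚ (B ⬝ w)) (eta_section (A := A))
    simp only [law_lambda, comp_I] at e
    rw [B_comp, B_comp B, tail₂ (hz.natural₁₂ _)] at e
    refine e.symm.trans ?_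
    simp only [comp_assoc]
  rw [key x hx, h, ← key y hy]

theorem Tr_eq_eta :
    (Tr : A) = bullet I ⊚ Tr ⊚ (B ⬝ C .pos) ⊚ bullet (C .neg) ⊚ B ⊚ B := by
  have hB : HasArity (B : A) 2 1 := HasArity.of_B
  have hR : HasArity (bullet (I : A) ⊚ Tr ⊚ (B ⬝ C .pos) ⊚ bullet (C .neg) ⊚ B ⊚ B) 1 2 :=
    (HasArity.of_bullet _).weaken.comp (hasArity_Tr.weaken.comp ((HasArity.of_C _).lift.comp
      ((HasArity.of_bullet _).weaken.weaken.weaken.comp (hB.weaken.weaken.comp hB.weaken))))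
  have h : (Tr : A) ⊚ C .neg
      = (bullet I ⊚ Tr ⊚ (B ⬝ C .pos) ⊚ bullet (C .neg) ⊚ B ⊚ B) ⊚ C .neg := by
    apply eq_of_comp_B_B (hasArity_Tr.comp (HasArity.of_C _)) (hR.comp (HasArity.of_C _))
    have hC := congrArg (fun z : A => B ⬝ z) (bullet_C_arity (A := A) .neg)
    simp only [B_comp] at hC
    simp only [comp_assoc]
    rw [Tr_comp_C_neg_comp, tail₄ (bullet_comp_B_B_comp_C _ _)]
    simp only [comp_assoc]
    rw [hC, ← comp_assoc (B ⬝ C .pos), ← B_comp, C_pos_neg, law_lambda, I_comp,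
      tail₂ (C_natural _ _), comp_assoc, tail₂ (Tr_natural _), comp_assoc,
      tail₂ (bullet_comp_B _ _), comp_assoc, tail₃ Tr_comp_C_neg_comp, comp_assoc,
      tail₂ (bullet_comp_B _ _), comp_assoc, tail₂ (bullet_C _ _), ← B_comp, bullet_I_comp_B,
      law_lambda, comp_I, C_comp_θ]
  have h' := congrArg (fun z : A => z ⊚ C .pos) h
  simp only [comp_assoc, C_neg_pos, comp_I] at h'
  exact h'

/-- Left superposing. -/
theorem Tr_conj_C (x : A) : Tr ⬝ (C .pos ⊚ (B ⬝ x) ⊚ C .neg) = B ⬝ (Tr ⬝ x) := by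
  rw [B_Tr, Tr_eq, B_comp, B_comp]
  conv_rhs => rw [Tr_eq_eta]
  simp only [comp_assoc]
  rw [← bullet_C_arity, tail₂ (bullet_comp_B _ _).symm, comp_assoc, tail₂ (B_natural _).symm,
    comp_assoc, tail₂ (B_natural _).symm, comp_assoc]

theorem Tr_Tr_comp_C_neg : Tr ⬝ (Tr ⊚ C .neg) = bullet (I : A) := by
  -- This gives the value `I` at `I`, which determines an element of arity 0 → 1.
  have h : (Tr ⬝ (Tr ⊚ C .neg)) ⊚ B = (I : A) := by
    rw [← Tr_comp_B, comp_assoc, Tr_comp_C_neg_comp, Tr_B_comp, Tr_C_neg, θ_pos_neg]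
  have ha : HasArity (Tr ⬝ (Tr ⊚ C .neg) : A) 0 1 :=
    hasArity_Tr_app (hasArity_Tr.comp (HasArity.of_C _))
  rw [hasArity_iff] at ha
  simp only [cpow, comp_I] at ha
  have h2 : (Tr ⬝ (Tr ⊚ C .neg)) ⬝ I = (I : A) := by
    have h3 := congrArg (fun y : A => y ⬝ I) h
    simpa only [comp_app, law_lambda, I_app] using h3
  have h4 := bullet_app (Tr ⬝ (Tr ⊚ C .neg)) (I : A)
  rw [h2, ha, tail₂ (bullet_comp_B _ _), comp_assoc, bullet_I_comp_B, comp_I] at h4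
  exact h4.symm

theorem Tr_conj_θ (x : A) : Tr ⬝ (θ .pos ⊚ x ⊚ θ .neg) = Tr ⬝ x := by
  -- By yanking, `x` is itself a trace; exchanging the two loops moves the twist.
  have h : x = Tr ⬝ ((B ⬝ (x ⊚ θ .neg)) ⊚ C .pos) := by
    rw [Tr_B_comp, Tr_C_pos, comp_assoc, θ_neg_pos, comp_I]
  conv_rhs => rw [h, ← Tr_exchange, comp_assoc, C_pos_neg, comp_I, Tr_comp_B, Tr_C_pos]

theorem Tr_θ_comp (x : A) : Tr ⬝ (θ .neg ⊚ x) = Tr ⬝ (x ⊚ θ .neg) := by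
  rw [← Tr_conj_θ, comp_assoc, tail₂ θ_pos_neg, I_comp]

/-- Sliding an application around a loop. -/
theorem Tr_slide {g : A} (hg : HasArity g 1 2) :
    Tr ⬝ (C .pos ⊚ B ⊚ g) =
      Tr ⬝ (g ⊚ θ .pos ⊚ C .pos ⊚ (B ⬝ C .pos) ⊚ C .pos ⊚ (B ⬝ C .pos) ⊚ B ⊚ θ .neg) := by
  -- A second loop is created by yanking, with `θ .neg` cancelling its twist, so that exchange
  -- applies.
  have h1 : C .pos ⊚ B ⊚ g = Tr ⬝ ((B ⬝ (C .pos ⊚ B ⊚ θ .neg)) ⊚ C .pos ⊚ (B ⬝ g)) := by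
    rw [Tr_B_comp, Tr_comp_B, Tr_C_pos]
    simp only [comp_assoc]
    rw [tail₂ θ_neg_pos, I_comp]
  have h2 : (B ⬝ g) ⊚ C .neg = C .neg ⊚ g ⊚ (B ⬝ C .pos) := by
    rw [tail₂ (C_comp_of_arity₁₂ .neg hg)]
    simp only [comp_assoc]
    rw [← B_comp, C_neg_pos, law_lambda, comp_I]
  have h3 : C .pos ⊚ ((B ⬝ (C .pos ⊚ B ⊚ θ .neg)) ⊚ C .pos ⊚ (B ⬝ g)) ⊚ C .neg =
      (B ⬝ g) ⊚ C .pos ⊚ (B ⬝ (C .pos ⊚ (B ⬝ C .pos) ⊚ (B ⬝ B) ⊚ (B ⬝ θ .neg) ⊚ C .pos)) := by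
    simp only [comp_assoc]
    rw [h2, tail₂ C_pos_neg, I_comp, tail₂ (hg.natural₁₂ _).symm, comp_assoc,
      tail₂ (C_comp_of_arity₁₂ _ hg)]
    simp only [comp_assoc, B_comp]
  rw [h1, ← Tr_exchange, h3, Tr_B_comp, Tr_comp_B, Tr_C_pos, ← C_comp_θ, tail₂ (law_bc _)]
  simp only [comp_assoc]

end TracedExtBCIAlgebra

/-! ### The duality: arities and zigzags. -/

variable {A : Type u} [TracedExtBCIAlgebra A]

theorem hasArity_dualUnit : HasArity (dualUnit A) 0 2 :=
  hasArity_Tr_app (hasArity_Tr.comp (hasArity_Tr.lift.comp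
    ((HasArity.of_C _).lift.comp (HasArity.of_C _).weaken)))

theorem hasArity_dualCounit : HasArity (dualCounit A) 2 0 :=
  hasArity_Tr_app ((HasArity.of_C _).weaken.comp ((HasArity.of_C _).lift.comp
    (HasArity.of_B.lift.comp HasArity.of_B)))

/-- The common value of both zigzags before the loop is slid away. -/
theorem Tr_zigzag :
    Tr ⬝ (Tr ⊚ (B ⬝ θ .pos) ⊚ (B ⬝ C .pos) ⊚ C .pos ⊚ (B ⬝ C .pos) ⊚ B ⊚ θ .neg) = (I : A) := by
  have h1 := Tr_slide (hasArity_Tr.comp (HasArity.of_C (A := A) .neg))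
  have h2 : C .pos ⊚ (B : A) ⊚ Tr ⊚ C .neg
      = C .pos ⊚ (B ⬝ (Tr ⊚ C .neg)) ⊚ C .neg ⊚ (B ⬝ (bullet B ⊚ B ⊚ B)) := by
    rw [tail₂ B_comp_Tr]
    simp only [comp_assoc]
    rw [bullet_comp_B_B_comp_C]
    simp only [comp_assoc, B_comp]
  have h3 : C .neg ⊚ θ .pos ⊚ C .pos = (B : A) ⬝ θ .pos := by
    rw [tail₂ (C_comp_θ _ _), comp_assoc, C_neg_pos, comp_I]
  simp only [comp_assoc] at h1
  rw [h2, ← comp_assoc (B ⬝ _), ← comp_assoc (C .pos), Tr_comp_B, Tr_conj_C, Tr_Tr_comp_C_neg,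
    B_bullet_I_comp, tail₃ h3] at h1
  rw [h1, tail₃ (yang_baxter _)]

theorem Tr_comp_C_comp_dualCounit :
    Tr ⊚ C .pos ⊚ (B ⬝ dualCounit A) = θ .pos ⊚ C .pos ⊚ B ⊚ θ .neg := by
  have h1 : Tr ⊚ C .pos ⊚ (B ⬝ dualCounit A) = Tr ⬝ ((B ⬝ Tr) ⊚ (B ⬝ C .pos) ⊚ C .pos ⊚
      (B ⬝ C .pos) ⊚ (B ⬝ (B ⬝ C .pos)) ⊚ (B ⬝ (B ⬝ B)) ⊚ (B ⬝ B) ⊚ C .neg) := by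
    rw [dualCounit, ← Tr_conj_C, ← comp_assoc Tr, ← Tr_B_comp]
    simp only [B_comp, comp_assoc]
  have h2 : ((B : A) ⬝ Tr) ⊚ (B ⬝ C .pos) ⊚ C .pos ⊚
      (B ⬝ C .pos) ⊚ (B ⬝ (B ⬝ C .pos)) ⊚ (B ⬝ (B ⬝ B)) ⊚ (B ⬝ B) ⊚ C .neg
      = C .pos ⊚ (B ⬝ (C .pos ⊚ B ⊚ θ .neg)) := by
    rw [tail₃ (yang_baxter (A := A) _)]
    simp only [comp_assoc]
    rw [tail₃ (C_comp_of_arity₁₂ .pos hasArity_Tr).symm]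
    simp only [comp_assoc]
    rw [tail₂ (C_natural _ _), comp_assoc, tail₂ (Tr_natural _), comp_assoc,
      tail₂ (C_natural _ _), comp_assoc, tail₂ (Tr_natural _), comp_assoc,
      tail₃ Tr_comp_C_pos_comp, comp_assoc, C_pos_neg, comp_I]
    simp only [B_comp]
  rw [h1, h2, Tr_comp_B, Tr_C_pos]

theorem B_dualUnit_comp_C_comp_B :
    (B ⬝ dualUnit A) ⊚ C .pos ⊚ B = θ .neg ⊚ Tr ⊚ C .pos ⊚ θ .pos := by
  have h1 : (B ⬝ dualUnit A) ⊚ C .pos ⊚ B = dualUnit A ⊚ (B ⬝ C .neg) ⊚ B := by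
    conv_rhs => rw [C_comp_of_arity₀₂ .pos hasArity_dualUnit]
    simp only [comp_assoc]
    rw [← comp_assoc (B ⬝ C .pos), ← B_comp, C_pos_neg, law_lambda, I_comp]
  have hg : HasArity (Tr ⊚ C .pos : A) 1 2 := hasArity_Tr.comp (HasArity.of_C _)
  have h2 : (Tr : A) ⊚ (B ⬝ Tr) ⊚ (B ⬝ C .pos) ⊚ C .pos ⊚ (B ⬝ (B ⬝ C .neg)) ⊚ (B ⬝ B)
      = (B ⬝ (θ .neg ⊚ Tr ⊚ C .pos)) ⊚ C .pos := by
    have h4 : C .pos ⊚ ((B : A) ⬝ B) = (B ⬝ C .neg) ⊚ B ⊚ C .pos := C_comp_B_B .pos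
    rw [tail₂ (C_natural _ _), comp_assoc, h4, ← Tr_C_neg, ← Tr_comp_B,
      C_comp_B_of_arity₁₂ .neg hg, B_Tr]
    simp only [comp_assoc, B_comp]
  rw [h1, dualUnit, ← comp_assoc (Tr ⬝ _), ← Tr_comp_B, ← Tr_comp_B]
  simp only [comp_assoc]
  rw [h2, Tr_B_comp, Tr_C_pos]
  simp only [comp_assoc]

theorem dualUnit_comp_dualCounit : dualUnit A ⊚ (B ⬝ dualCounit A) = I := by
  have h := congrArg (fun x : A => B ⬝ x) (Tr_comp_C_comp_dualCounit (A := A))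
  simp only [B_comp] at h
  rw [dualUnit, ← Tr_comp_B]
  simp only [comp_assoc]
  rw [C_natural, tail₃ h]
  simp only [comp_assoc]
  rw [← C_comp_θ, tail₂ (law_bc _)]
  simp only [comp_assoc]
  exact Tr_zigzag

theorem B_dualUnit_comp_dualCounit : (B ⬝ dualUnit A) ⊚ dualCounit A = I := by
  have hg : HasArity (θ .neg ⊚ Tr ⊚ C .pos ⊚ θ .pos : A) 1 2 :=
    (hasArity_θ _).comp (hasArity_Tr.comp ((HasArity.of_C _).comp (hasArity_θ _).weaken))
  have h := congrArg (fun x : A => B ⬝ x) (B_dualUnit_comp_C_comp_B (A := A))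
  rw [B_comp, B_comp] at h
  rw [dualCounit, ← Tr_B_comp, tail₂ (C_natural _ _).symm, comp_assoc, tail₃ h,
    tail₂ (C_comp_B_of_arity₁₂ _ hg)]
  simp only [comp_assoc]
  -- Cycling the leading `θ .neg` to the end matches `Tr_zigzag` up to Yang–Baxter.
  rw [Tr_θ_comp]
  simp only [comp_assoc]
  rw [tail₂ (C_comp_θ _ _), comp_assoc, tail₃ (yang_baxter (A := A) _).symm]
  simp only [comp_assoc]
  exact Tr_zigzag

end CombAlg

theorem mainTheorem8 (A : Type*) [CombAlg.TracedExtBCIAlgebra A] :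
    CombAlg.HasArity (CombAlg.dualUnit A) 0 2 ∧
    CombAlg.HasArity (CombAlg.dualCounit A) 2 0 ∧
    CombAlg.IsDuality (CombAlg.dualUnit A) (CombAlg.dualCounit A) := by
  refine ⟨CombAlg.hasArity_dualUnit, CombAlg.hasArity_dualCounit, ?_, ?_, ?_, ?_⟩
  · have h := CombAlg.ExtBCIAlgebra.hasArity_iff.1 (CombAlg.hasArity_dualUnit (A := A))
    rwa [CombAlg.cpow, CombAlg.cpow, CombAlg.ExtBCIAlgebra.comp_I] at h
  · have h := CombAlg.ExtBCIAlgebra.hasArity_iff.1 (CombAlg.hasArity_dualCounit (A := A))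
    rwa [CombAlg.cpow.eq_1, CombAlg.ExtBCIAlgebra.comp_I] at h
  · rw [CombAlg.dualUnit_comp_dualCounit, CombAlg.ExtBCIAlgebra.law_lambda]
  · rw [CombAlg.B_dualUnit_comp_dualCounit, CombAlg.ExtBCIAlgebra.law_lambda]
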